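/- Let $\mathbb{N}$ be the set of positive integers, $X=\{a,b,\ell,r\}$ and let $M_1$ be the monoid with presentation $$M_1=\langle a,b,\ell,r \mid \ell a^n b^n r=\ell b^n a^n r\ (n\in\mathbb{N})\rangle .$$ Let $\iota(M_1,X)\subseteq X^*\times X^*$ be its word problem relation, that is, the set of all pairs $(u,v)$ of words over $X$ that represent the same element of $M_1$. Then: 1. There is a one-counter language $L$ over the alphabet $X_\varepsilon^2=(X\cup\{\varepsilon\})\times(X\cup\{\varepsilon\})$ such that $\iota(M_1,X)=L\pi$, where $\pi$ maps a word $(x_1,y_1)\cdots(x_k,y_k)$ over $X_\varepsilon^2$ to the pair of words $(x_1\cdots x_k,\;y_1\cdots y_k)$. (In other words, the word problem of $M_1$ is in $T(\mathcal{O})$.) 2. The language $\{u\#v^{\mathrm{rev}} : (u,v)\in\iota(M_1,X)\}$ over $X\cup\{\#\}$, where $\#\notin X$ is a new symbol and $v^{\mathrm{rev}}$ is the reverse of $v$, is not context-free. (In other words, the word problem of $M_1$ is not in $U(\mathcal{CF})$.) Here a language is one-counter if it is accepted, by final state, by a nondeterministic pushdown automaton (with $\varepsilon$-moves) whose stack alphabet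 has a single symbol besides the bottom-of-stack marker; equivalently, by a finite-state automaton with a counter holding a natural number, initially zero, which it can increment, decrement and test for zero. -/

import Mathlib

namespace WordRelations

/-- A class of languages: for every finite alphabet, a set of languages over it. -/
abbrev LanguageClass : Type 1 := ∀ (α : Type) [Finite α], Set (Language α)

/-- Actions on a counter holding a natural number. -/
inductive CounterOp : Type
  | inc
  | dec
  | keep

/-- `op.Acts n m`: performing `op` on a counter with value `n` results in the value `m`.
A decrement is impossible when the counter is at zero. -/
def CounterOp.Acts : CounterOp → ℕ → ℕ → Prop
  | inc, n, m => m = n + 1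
  | dec, n, m => n = m + 1
  | keep, n, m => m = n

/-- A (nondeterministic) one-counter automaton over `α`, that is, a pushdown automaton with a single
stack symbol besides the bottom marker: finitely many states, and a counter holding a natural number
that can be incremented, decremented and tested for zero. A transition
`trans q x z p op` leads from state `q` to state `p`, reads `x` (nothing if `x = none`), performs
`op` on the counter, and is available when the truth value of "the counter is zero" is `z`. -/
structure OneCounterAutomaton (α : Type) where
  State : Type
  finite_state : Finite State
  start : State
  accept : Set State
  trans : State → Option α → Bool → State → CounterOp → Prop

namespace OneCounterAutomaton

variable {α : Type} (A : OneCounterAutomaton α)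

/-- `A.Run q n w p m`: the automaton `A` can get from state `q` with counter value `n` to state `p`
with counter value `m` while reading the word `w`. -/
inductive Run : A.State → ℕ → List α → A.State → ℕ → Prop
  | refl (q : A.State) (n : ℕ) : Run q n [] q n
  | step {q q' p : A.State} {n n' m : ℕ} {x : Option α} {w : List α} {op : CounterOp} :
      A.trans q x (decide (n = 0)) q' op → op.Acts n n' → Run q' n' w p m →
        Run q n (x.toList ++ w) p m

/-- The language accepted (by final state, the counter starting at zero). -/
def language : Language α :=
  {w | ∃ q ∈ A.accept, ∃ n : ℕ, A.Run A.start 0 w q n}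

end OneCounterAutomaton

/-- The class `𝒪` of one-counter languages. -/
def oneCounter : LanguageClass :=
  fun α _ => {L | ∃ A : OneCounterAutomaton α, A.language = L}

/-- The class `𝒞ℱ` of context-free languages. -/
def contextFree : LanguageClass :=
  fun _ _ => {L | L.IsContextFree}

/-- The map `π` from words over `(X ∪ {ε}) × (X ∪ {ε})` to pairs of words over `X`, where `ε` is
`none`: concatenate the first components, and the second components. -/
def tapes {X : Type} (w : List (Option X × Option X)) : List X × List X :=
  (w.flatMap fun p => p.1.toList, w.flatMap fun p => p.2.toList)

/-- The unfolding `{u # v^rev | (u, v) ∈ ρ}` of a relation, a language over `X ∪ {#}`,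
where `#` is `none`. -/
def unfold {X : Type} (ρ : Set (List X × List X)) : Language (Option X) :=
  {w | ∃ u v : List X, (u, v) ∈ ρ ∧ w = u.map some ++ [none] ++ v.reverse.map some}

/-- `T(C)`, the two-tape relations over `X`: the images `π(L)` of the languages `L` in `C`. -/
def T (C : LanguageClass) (X : Type) [Finite X] : Set (Set (List X × List X)) :=
  {ρ | ∃ L ∈ C (Option X × Option X), ρ = tapes '' (L : Set (List (Option X × Option X)))}

/-- `U(C)`, the unfolded relations over `X`: those whose unfolding is in `C`. -/
def U (C : LanguageClass) (X : Type) [Finite X] : Set (Set (List X × List X)) :=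
  {ρ | unfold ρ ∈ C (Option X)}

/-- The word problem relation `ι(M, X)` of a monoid `M` with respect to generators indexed by `X`:
all pairs of words over `X` that represent the same element of `M`. -/
def wordProblem {X M : Type} [Monoid M] (gen : X → M) : Set (List X × List X) :=
  {p | (p.1.map gen).prod = (p.2.map gen).prod}

/-- The alphabet `{a, b, ℓ, r}`. -/
inductive Letter : Type
  | a
  | b
  | l
  | r
  deriving DecidableEq

instance : Fintype Letter where
  elems := {.a, .b, .l, .r}
  complete x := by cases x <;> simp

open FreeMonoid in
/-- The defining relations `ℓ aⁿ bⁿ r = ℓ bⁿ aⁿ r`, for `n ∈ ℕ` (the one for `n = 0` is trivial). -/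
inductive M₁Rel : FreeMonoid Letter → FreeMonoid Letter → Prop
  | swap (n : ℕ) :
      M₁Rel (of .l * of .a ^ n * of .b ^ n * of .r) (of .l * of .b ^ n * of .a ^ n * of .r)

/-- The monoid `M₁ = ⟨a, b, ℓ, r | ℓ aⁿ bⁿ r = ℓ bⁿ aⁿ r (n ∈ ℕ)⟩`. -/
abbrev M₁ : Type := PresentedMonoid M₁Rel

end WordRelations

namespace WordRelations

open Letter

/-! Every left-hand or right-hand side of a defining relation starts with `l`, ends with `r` and
contains neither in between. Rewritten factors therefore never overlap, and two rewritings at the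
same `l` compose to a rewriting or cancel. So `SwapEquiv`, one simultaneous rewriting of disjoint
factors, is already the whole congruence (`conGen_iff_swapEquiv`). An automaton reading both words
in parallel guesses these factors and uses the counter to compare the two blocks of each.

For the negative part, take the words `ℓ aⁿ bⁿ r # r aⁿ bⁿ ℓ`. In a context-free language, each has
a factor of length between `n / 2` and `n` that may be exchanged with any factor of the same kind,
with finitely many kinds (`exists_interchange`). The relations preserve letter counts, so an
exchange must keep the two sides of `#` balanced. A factor of length at most `n` around `#` sees
only `b`s on the left and `a`s on the right, so neither side can compensate for the other, and its
length is fixed up to 2 (`length_le_of_interchange`). Letting `n` run through the powers of 8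
contradicts finiteness. -/

/-! ### The congruence of `M₁` as disjoint swaps. -/

/-- The letter `a` or `b`. -/
def ab : Bool → Letter
  | true => a
  | false => b

/-- The word `aⁿ bⁿ r` or `bⁿ aⁿ r`. -/
def core (c : Bool) (n : ℕ) : List Letter :=
  List.replicate n (ab c) ++ (List.replicate n (ab !c) ++ [r])

/-- An inductive description of the word problem of `M₁`: the two words agree except for disjoint
factors in which a defining relation is applied. -/
inductive SwapEquiv : List Letter → List Letter → Prop
  | nil : SwapEquiv [] []
  | cons (x : Letter) {u v : List Letter} : SwapEquiv u v → SwapEquiv (x :: u) (x :: v)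
  | swap (c : Bool) (n : ℕ) {u v : List Letter} : SwapEquiv u v →
      SwapEquiv (l :: (core c n ++ u)) (l :: (core (!c) n ++ v))

theorem ab_ne_l (c : Bool) : ab c ≠ l := by cases c <;> simp [ab]

theorem ab_ne_r (c : Bool) : ab c ≠ r := by cases c <;> simp [ab]

theorem ab_injective : Function.Injective ab := by
  intro c d; cases c <;> cases d <;> simp [ab]

theorem l_notMem_core (c : Bool) (n : ℕ) : l ∉ core c n := by
  simp [core, List.mem_replicate, (ab_ne_l _).symm]

/-- The first `r` marks the end of the core. The conclusion compares cores, not the bits `c` and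
`d`, because for `n = 0` the bits are not determined. -/
theorem core_append_inj {c d : Bool} {n m : ℕ} {u v : List Letter}
    (h : core (!c) n ++ u = core d m ++ v) : core c n = core (!d) m ∧ u = v := by
  have key : ∀ (e : Bool) (k : ℕ) (w : List Letter), core e k ++ w =
      (List.replicate k (ab e) ++ List.replicate k (ab !e)) ++ r :: w := by
    intro e k w; simp [core]
  have hr : ∀ (e : Bool) (k : ℕ),
      r ∉ List.replicate k (ab e) ++ List.replicate k (ab !e) := by
    intro e k; simp [List.mem_replicate, (ab_ne_r _).symm]
  rw [key, key] at h
  have h1 : List.replicate n (ab !c) ++ List.replicate n (ab !!c) =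
      List.replicate m (ab d) ++ List.replicate m (ab !d) ∧ u = v := by
    rcases List.append_eq_append_iff.1 h with ⟨s, h1, h2⟩ | ⟨s, h1, h2⟩
    · cases s with
      | nil => simp_all
      | cons y s =>
        simp only [List.cons_append, List.cons.injEq] at h2
        exact absurd (h1 ▸ by simp [← h2.1]) (hr d m)
    · cases s with
      | nil => simp_all
      | cons y s =>
        simp only [List.cons_append, List.cons.injEq] at h2
        exact absurd (h1 ▸ by simp [← h2.1]) (hr (!c) n)
  refine ⟨?_, h1.2⟩
  have hlen := congrArg List.length h1.1
  simp only [List.length_append, List.length_replicate] at hlen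
  obtain rfl : n = m := by omega
  cases n with
  | zero => rfl
  | succ n =>
    have := h1.1
    simp only [List.replicate_succ, List.cons_append, List.cons.injEq] at this
    rw [← ab_injective this.1, Bool.not_not]

namespace SwapEquiv

theorem refl : ∀ u : List Letter, SwapEquiv u u
  | [] => nil
  | x :: u => cons x (refl u)

theorem symm {u v : List Letter} (h : SwapEquiv u v) : SwapEquiv v u := by
  induction h with
  | nil => exact nil
  | cons x _ ih => exact cons x ih
  | swap c n _ ih => simpa using swap (!c) n ih

theorem append {u v u' v' : List Letter} (h : SwapEquiv u v) (h' : SwapEquiv u' v') :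
    SwapEquiv (u ++ u') (v ++ v') := by
  induction h with
  | nil => exact h'
  | cons x _ ih => exact cons x ih
  | swap c n _ ih => simpa using swap c n ih

/-- Changes only occur in a factor opened by `l`, so an `l`-free prefix is frozen. -/
theorem eq_append_of_notMem {p u v : List Letter} (hp : l ∉ p) (h : SwapEquiv (p ++ u) v) :
    ∃ v', v = p ++ v' ∧ SwapEquiv u v' := by
  induction p generalizing v with
  | nil => exact ⟨v, rfl, h⟩
  | cons x p ih =>
    rw [List.mem_cons, not_or] at hp
    generalize hs : (x :: p) ++ u = s at h
    rw [List.cons_append] at hs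
    cases h with
    | nil => simp at hs
    | cons _ h =>
      obtain ⟨rfl, rfl⟩ := List.cons.inj hs
      obtain ⟨v', rfl, hv⟩ := ih hp.2 h
      exact ⟨v', rfl, hv⟩
    | swap c n h => exact absurd (List.cons.inj hs).1.symm hp.1

theorem trans {u v w : List Letter} (h : SwapEquiv u v) (h' : SwapEquiv v w) :
    SwapEquiv u w := by
  induction h generalizing w with
  | nil => exact h'
  | @cons x u v h ih =>
    generalize hy : x :: v = y at h'
    cases h' with
    | nil => simp at hy
    | cons _ h' =>
      obtain ⟨rfl, rfl⟩ := List.cons.inj hy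
      exact cons _ (ih h')
    | swap c n h' =>
      obtain ⟨rfl, rfl⟩ := List.cons.inj hy
      obtain ⟨u', rfl, hu⟩ := eq_append_of_notMem (l_notMem_core c n) h.symm
      -- The induction hypothesis concerns the whole tail, so the unchanged core is put back in
      -- front and then stripped again.
      have := ih ((refl (core c n)).append h')
      obtain ⟨s, hs, hs'⟩ := eq_append_of_notMem (l_notMem_core c n) this
      rw [List.append_cancel_left_eq] at hs
      exact swap c n (hs ▸ hs')
  | @swap c n u v h ih =>
    generalize hy : l :: (core (!c) n ++ v) = y at h'
    cases h' with
    | nil => simp at hy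
    | cons _ h' =>
      obtain ⟨rfl, rfl⟩ := List.cons.inj hy
      obtain ⟨w', rfl, hw⟩ := eq_append_of_notMem (l_notMem_core _ n) h'
      exact swap c n (ih hw)
    | swap d m h' =>
      obtain ⟨hc, rfl⟩ := core_append_inj (List.cons.inj hy).2
      rw [hc]
      exact cons _ ((refl _).append (ih h'))

theorem perm {u v : List Letter} (h : SwapEquiv u v) : u.Perm v := by
  induction h with
  | nil => exact .refl _
  | cons x _ ih => exact ih.cons x
  | swap c n _ ih =>
    refine List.Perm.cons _ (List.Perm.append ?_ ih)
    simp only [core, Bool.not_not, ← List.append_assoc]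
    exact List.perm_append_comm.append_right _

end SwapEquiv

theorem ofList_core (c : Bool) (n : ℕ) : FreeMonoid.ofList (l :: core c n) =
    FreeMonoid.of l * FreeMonoid.of (ab c) ^ n * FreeMonoid.of (ab !c) ^ n * FreeMonoid.of r := by
  have : ∀ x : Letter, FreeMonoid.ofList (List.replicate n x) = FreeMonoid.of x ^ n := by
    intro x
    induction n with
    | zero => rfl
    | succ n ih => rw [pow_succ', List.replicate_succ, FreeMonoid.ofList_cons, ih]
  simp [core, this, mul_assoc, FreeMonoid.ofList_cons, FreeMonoid.ofList_append]

/-- `SwapEquiv` is itself a congruence containing the relations, transitivity being the substantial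
point. -/
theorem conGen_iff_swapEquiv (u v : FreeMonoid Letter) :
    conGen M₁Rel u v ↔ SwapEquiv u.toList v.toList := by
  constructor
  · intro h
    induction (h : ConGen.Rel M₁Rel u v) with
    | of _ _ h =>
      obtain ⟨n⟩ := h
      have h1 := ofList_core true n
      have h2 := ofList_core false n
      simp only [ab, Bool.not_true, Bool.not_false] at h1 h2
      rw [← h1, ← h2]
      simpa using SwapEquiv.swap true n .nil
    | refl x => exact .refl _
    | symm _ ih => exact ih.symm
    | trans _ _ ih ih' => exact ih.trans ih'
    | mul _ _ ih ih' => exact ih.append ih'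
  · suffices ∀ u v, SwapEquiv u v → conGen M₁Rel (.ofList u) (.ofList v) from this _ _
    intro u v h
    induction h with
    | nil => exact (conGen M₁Rel).refl _
    | cons x _ ih => exact (conGen M₁Rel).mul ((conGen M₁Rel).refl (.of x)) ih
    | swap c n _ ih =>
      rw [← List.cons_append, ← List.cons_append, FreeMonoid.ofList_append,
        FreeMonoid.ofList_append]
      refine (conGen M₁Rel).mul ?_ ih
      rw [ofList_core, ofList_core]
      cases c
      · exact (conGen M₁Rel).symm (ConGen.Rel.of _ _ (.swap n))
      · exact ConGen.Rel.of _ _ (.swap n)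

theorem mem_wordProblem_iff (u v : List Letter) :
    (u, v) ∈ wordProblem (PresentedMonoid.of M₁Rel : Letter → M₁) ↔ SwapEquiv u v := by
  have : ∀ w : List Letter, (w.map (PresentedMonoid.of M₁Rel)).prod =
      PresentedMonoid.mk M₁Rel (.ofList w) := by
    intro w
    induction w with
    | nil => rfl
    | cons x w ih => rw [List.map_cons, List.prod_cons, ih, FreeMonoid.ofList_cons, map_mul]; rfl
  change (u.map _).prod = (v.map _).prod ↔ _
  rw [this, this, PresentedMonoid.mk_eq_mk_iff, conGen_iff_swapEquiv]
  rfl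

/-! ### The one-counter automaton. -/

/-- The transitions of an automaton for the word problem of `M₁`. In the state `none` the automaton
copies letters; in the state `some (c, false)` it counts the letters of a first block, and in the
state `some (c, true)` it compares that number with the length of the second block. -/
inductive SwapTrans : Option (Bool × Bool) → Option (Option Letter × Option Letter) → Bool →
    Option (Bool × Bool) → CounterOp → Prop
  | copy (x : Letter) : SwapTrans none (some (some x, some x)) true none .keep
  | enter (c : Bool) : SwapTrans none (some (some l, some l)) true (some (c, false)) .keep
  | up (c z : Bool) :
      SwapTrans (some (c, false)) (some (some (ab c), some (ab !c))) z (some (c, false)) .inc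
  | turn (c z : Bool) : SwapTrans (some (c, false)) none z (some (c, true)) .keep
  | down (c : Bool) :
      SwapTrans (some (c, true)) (some (some (ab !c), some (ab c))) false (some (c, true)) .dec
  | leave (c : Bool) : SwapTrans (some (c, true)) (some (some r, some r)) true none .keep

/-- A one-counter automaton for the word problem of `M₁`. -/
def swapAutomaton : OneCounterAutomaton (Option Letter × Option Letter) where
  State := Option (Bool × Bool)
  finite_state := inferInstance
  start := none
  accept := {none}
  trans := SwapTrans

/-- The pairs of words accepted from a given state and counter value. -/
def SwapAccepts : Option (Bool × Bool) → ℕ → List Letter → List Letter → Prop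
  | none, n, u, v => n = 0 → SwapEquiv u v
  | some (c, true), n, u, v => ∃ u' v', SwapEquiv u' v' ∧
      u = List.replicate n (ab !c) ++ r :: u' ∧ v = List.replicate n (ab c) ++ r :: v'
  | some (c, false), n, u, v => ∃ k u' v', SwapEquiv u' v' ∧
      u = List.replicate k (ab c) ++ (List.replicate (n + k) (ab !c) ++ r :: u') ∧
      v = List.replicate k (ab !c) ++ (List.replicate (n + k) (ab c) ++ r :: v')

theorem tapes_cons {X : Type} (x y : Option X) (w : List (Option X × Option X)) :
    tapes ((x, y) :: w) = (x.toList ++ (tapes w).1, y.toList ++ (tapes w).2) := by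
  simp [tapes]

/-- `SwapAccepts` is an invariant propagated backwards along the run. In the first block, `n`
letters are already counted and `k` remain, so the second block has length `n + k`. -/
theorem swapAccepts_of_run {q p : swapAutomaton.State} {n m : ℕ}
    {w : List (Option Letter × Option Letter)} (h : swapAutomaton.Run q n w p m)
    (hp : p = none) : SwapAccepts q n (tapes w).1 (tapes w).2 := by
  induction h with
  | refl q n => subst hp; exact fun _ => .nil
  | @step q q' p n n' m x w op ht hop hrun ih =>
    replace ih := ih hp
    replace ht : SwapTrans q x (decide (n = 0)) q' op := ht
    generalize hz : decide (n = 0) = z at ht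
    cases ht with
    | copy x =>
      intro hn
      simp only [Option.toList_some, List.singleton_append, tapes_cons]
      exact .cons x (ih (hop.trans hn))
    | enter c =>
      intro hn
      subst hn
      obtain rfl : n' = 0 := hop
      obtain ⟨k, u, v, h, hu, hv⟩ := ih
      simp only [Option.toList_some, List.singleton_append, tapes_cons]
      rw [hu, hv]
      simpa [core] using SwapEquiv.swap c k h
    | up c z =>
      obtain rfl : n' = n + 1 := hop
      obtain ⟨k, u, v, h, hu, hv⟩ := ih
      refine ⟨k + 1, u, v, h, ?_⟩
      simp only [Option.toList_some, List.singleton_append, tapes_cons]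
      rw [hu, hv, show n + (k + 1) = n + 1 + k by omega, List.replicate_succ (n := k),
        List.replicate_succ (n := k)]
      exact ⟨rfl, rfl⟩
    | turn c z =>
      obtain rfl : n' = n := hop
      obtain ⟨u, v, h, hu, hv⟩ := ih
      exact ⟨0, u, v, h, by simpa using hu, by simpa using hv⟩
    | down c =>
      obtain rfl : n = n' + 1 := hop
      obtain ⟨u, v, h, hu, hv⟩ := ih
      refine ⟨u, v, h, ?_⟩
      simp only [Option.toList_some, List.singleton_append, tapes_cons]
      rw [hu, hv]
      exact ⟨rfl, rfl⟩
    | leave c =>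
      obtain rfl : n = 0 := by simpa using hz
      simp only [Option.toList_some, List.singleton_append, tapes_cons]
      exact ⟨_, _, ih hop, rfl, rfl⟩

theorem exists_run_of_swapEquiv {u v : List Letter} (h : SwapEquiv u v) :
    ∃ w, tapes w = (u, v) ∧ swapAutomaton.Run none 0 w none 0 := by
  have step : ∀ {q q' : Option (Bool × Bool)} {n n' : ℕ}
      {x : Option Letter × Option Letter} {w} {op : CounterOp},
      SwapTrans q (some x) (decide (n = 0)) q' op → op.Acts n n' →
      swapAutomaton.Run q' n' w none 0 → swapAutomaton.Run q n (x :: w) none 0 :=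
    fun h h' h'' => .step (x := some _) h h' h''
  induction h with
  | nil => exact ⟨[], rfl, .refl _ _⟩
  | cons x _ ih =>
    obtain ⟨w, hw, hrun⟩ := ih
    refine ⟨(some x, some x) :: w, ?_, step (.copy x) rfl hrun⟩
    rw [tapes_cons, hw]; rfl
  | @swap c n u v _ ih =>
    obtain ⟨w, hw, hrun⟩ := ih
    have hdown : ∀ k, ∃ w', tapes w' = (List.replicate k (ab !c) ++ r :: u,
        List.replicate k (ab c) ++ r :: v) ∧ swapAutomaton.Run (some (c, true)) k w' none 0 := by
      intro k
      induction k with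
      | zero =>
        refine ⟨(some r, some r) :: w, ?_, step (.leave c) rfl hrun⟩
        rw [tapes_cons, hw]; rfl
      | succ k ih =>
        obtain ⟨w', hw', hrun'⟩ := ih
        refine ⟨(some (ab !c), some (ab c)) :: w', ?_, step (.down c) rfl hrun'⟩
        rw [tapes_cons, hw']; rfl
    have hup : ∀ j k, j + k = n → ∃ w', tapes w' =
        (List.replicate j (ab c) ++ (List.replicate n (ab !c) ++ r :: u),
          List.replicate j (ab !c) ++ (List.replicate n (ab c) ++ r :: v)) ∧
        swapAutomaton.Run (some (c, false)) k w' none 0 := by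
      intro j
      induction j with
      | zero =>
        rintro k hk
        obtain rfl : k = n := by omega
        obtain ⟨w', hw', hrun'⟩ := hdown k
        exact ⟨w', hw', OneCounterAutomaton.Run.step (x := none) (SwapTrans.turn c _)
          (rfl : CounterOp.keep.Acts k k) hrun'⟩
      | succ j ih =>
        intro k hk
        obtain ⟨w', hw', hrun'⟩ := ih (k + 1) (by omega)
        refine ⟨(some (ab c), some (ab !c)) :: w', ?_, step (.up c _) rfl hrun'⟩
        rw [tapes_cons, hw']; rfl
    obtain ⟨w', hw', hrun'⟩ := hup n 0 rfl
    refine ⟨(some l, some l) :: w', ?_, step (.enter c) rfl hrun'⟩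
    rw [tapes_cons, hw']
    simp [core]

theorem wordProblem_mem_T_oneCounter :
    wordProblem (PresentedMonoid.of M₁Rel : Letter → M₁) ∈ T oneCounter Letter := by
  refine ⟨swapAutomaton.language, ⟨swapAutomaton, rfl⟩, ?_⟩
  ext ⟨u, v⟩
  rw [mem_wordProblem_iff]
  constructor
  · intro h
    obtain ⟨w, hw, hrun⟩ := exists_run_of_swapEquiv h
    exact ⟨w, ⟨none, rfl, 0, hrun⟩, hw⟩
  · rintro ⟨w, ⟨q, hq, n, hrun⟩, hw⟩
    have := swapAccepts_of_run hrun hq rfl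
    rwa [hw] at this

/-! ### Parse forests and interchange in context-free languages. -/

/-- `ParsesTo g s w`: the word `w` is the frontier of a forest of parse trees of `g` with
roots `s`. -/
inductive ParsesTo {α : Type} (g : ContextFreeGrammar α) :
    List (Symbol α g.NT) → List α → Prop
  | nil : ParsesTo g [] []
  | terminal (c : α) {s : List (Symbol α g.NT)} {w : List α} : ParsesTo g s w →
      ParsesTo g (.terminal c :: s) (c :: w)
  | nonterminal {ρ : ContextFreeRule α g.NT} {s : List (Symbol α g.NT)} {w w' : List α} :
      ρ ∈ g.rules → ParsesTo g ρ.output w → ParsesTo g s w' →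
      ParsesTo g (.nonterminal ρ.input :: s) (w ++ w')

namespace ParsesTo

variable {α : Type} {g : ContextFreeGrammar α}

theorem append {s s' : List (Symbol α g.NT)} {w w' : List α} (h : ParsesTo g s w)
    (h' : ParsesTo g s' w') : ParsesTo g (s ++ s') (w ++ w') := by
  induction h with
  | nil => exact h'
  | terminal c _ ih => exact .terminal c ih
  | nonterminal hρ h _ _ ih => rw [List.append_assoc]; exact .nonterminal hρ h ih

theorem exists_of_append {s s' : List (Symbol α g.NT)} {w : List α}
    (h : ParsesTo g (s ++ s') w) :
    ∃ w₁ w₂, w = w₁ ++ w₂ ∧ ParsesTo g s w₁ ∧ ParsesTo g s' w₂ := by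
  induction s generalizing w with
  | nil => exact ⟨[], w, rfl, .nil, h⟩
  | cons x s ih =>
    rw [List.cons_append] at h
    cases h with
    | terminal c h =>
      obtain ⟨w₁, w₂, rfl, h₁, h₂⟩ := ih h
      exact ⟨_, w₂, rfl, .terminal c h₁, h₂⟩
    | nonterminal hρ h h' =>
      obtain ⟨w₁, w₂, rfl, h₁, h₂⟩ := ih h'
      exact ⟨_, w₂, (List.append_assoc ..).symm, .nonterminal hρ h h₁, h₂⟩

theorem of_derives {s : List (Symbol α g.NT)} {w : List α}
    (h : g.Derives s (w.map .terminal)) : ParsesTo g s w := by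
  induction h using Relation.ReflTransGen.head_induction_on with
  | refl =>
    induction w with
    | nil => exact .nil
    | cons c w ih => exact .terminal c ih
  | head h _ ih =>
    obtain ⟨ρ, hρ, h⟩ := h
    obtain ⟨p, q, rfl, rfl⟩ := h.exists_parts
    obtain ⟨w₁, w₂, rfl, h₁, h₂⟩ := ih.exists_of_append
    obtain ⟨w₃, w₄, rfl, h₃, h₄⟩ := h₁.exists_of_append
    have := h₃.append (nonterminal hρ h₄ h₂)
    simpa using this

theorem derives {s : List (Symbol α g.NT)} {w : List α} (h : ParsesTo g s w) :
    g.Derives s (w.map .terminal) := by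
  induction h with
  | nil => exact Relation.ReflTransGen.refl
  | terminal c _ ih => exact ih.append_left [.terminal c]
  | @nonterminal ρ s w w' hρ _ _ ih ih' =>
    have h1 : g.Derives [.nonterminal ρ.input] (w.map .terminal) :=
      ContextFreeGrammar.Produces.trans_derives ⟨ρ, hρ, ContextFreeRule.Rewrites.input_output⟩ ih
    rw [List.map_append]
    exact (h1.append_right s).trans (ih'.append_left _)

/-- Descend in the forest: while the frontier is longer than `t`, drop a leading terminal or pass to
the longer of the first tree's children and the remaining trees. Each move keeps the length above `t
/ 2`; for a dropped terminal this needs `1 ≤ t`. -/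
theorem exists_factor {S : Set (List (Symbol α g.NT))}
    (htail : ∀ x s, x :: s ∈ S → s ∈ S) (hrule : ∀ ρ ∈ g.rules, ρ.output ∈ S)
    {L : Set (List α)} {t : ℕ} (ht : 1 ≤ t) {s : List (Symbol α g.NT)} {y : List α}
    (h : ParsesTo g s y) (hs : s ∈ S) (hy : t < 2 * y.length) {x z : List α}
    (hL : ∀ y', ParsesTo g s y' → x ++ y' ++ z ∈ L) :
    ∃ s' ∈ S, ∃ x' y' z', x' ++ y' ++ z' = x ++ y ++ z ∧ y'.length ≤ t ∧ t < 2 * y'.length ∧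
      ParsesTo g s' y' ∧ ∀ y'', ParsesTo g s' y'' → x' ++ y'' ++ z' ∈ L := by
  induction h generalizing x z with
  | nil => simp at hy
  | @terminal c s w h ih =>
    by_cases hle : (c :: w).length ≤ t
    · exact ⟨_, hs, x, _, z, rfl, hle, hy, .terminal c h, hL⟩
    rw [List.length_cons] at hle
    obtain ⟨s', hs', x', y', z', heq, H⟩ := ih (htail _ _ hs) (by omega) (x := x ++ [c]) (z := z)
      (fun y' hy' => by simpa using hL _ (.terminal c hy'))
    exact ⟨s', hs', x', y', z', by simpa using heq, H⟩
  | @nonterminal ρ s w w' hρ h h' ih ih' =>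
    by_cases hle : (w ++ w').length ≤ t
    · exact ⟨_, hs, x, _, z, rfl, hle, hy, .nonterminal hρ h h', hL⟩
    rw [List.length_append] at hle
    rcases le_total w'.length w.length with hw | hw
    · obtain ⟨s', hs', x', y', z', heq, H⟩ := ih (hrule _ hρ) (by omega) (x := x) (z := w' ++ z)
        (fun y' hy' => by simpa using hL _ (.nonterminal hρ hy' h'))
      exact ⟨s', hs', x', y', z', by simpa using heq, H⟩
    · obtain ⟨s', hs', x', y', z', heq, H⟩ := ih' (htail _ _ hs) (by omega) (x := x ++ w) (z := z)
        (fun y' hy' => by simpa using hL _ (.nonterminal hρ h hy'))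
      exact ⟨s', hs', x', y', z', by simpa using heq, H⟩

end ParsesTo

/-- An interchange lemma for context-free languages: there are finitely many kinds of factors such
that every word of the language has a factor of prescribed approximate length that can be replaced
by every other word of its kind. -/
theorem exists_interchange {α : Type} {L : Language α} (hL : L.IsContextFree) :
    ∃ (ι : Type) (_ : Finite ι) (P : ι → List α → Prop), ∀ w ∈ L, ∀ t : ℕ, 1 ≤ t →
      t ≤ w.length → ∃ i x y z, x ++ y ++ z = w ∧ y.length ≤ t ∧ t < 2 * y.length ∧ P i y ∧
        ∀ y', P i y' → x ++ y' ++ z ∈ L := by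
  obtain ⟨g, rfl⟩ := hL
  -- The descent only meets suffixes of rule outputs and of the initial forest; sublists include
  -- these and are still finitely many.
  let S : Set (List (Symbol α g.NT)) :=
    {s | s ∈ [.nonterminal g.initial].sublists} ∪ ⋃ ρ ∈ g.rules, {s | s ∈ ρ.output.sublists}
  have hS : S.Finite := (List.finite_toSet _).union
    (g.rules.finite_toSet.biUnion fun ρ _ => List.finite_toSet _)
  have htail : ∀ x s, x :: s ∈ S → s ∈ S := by
    intro x s h
    simp only [S, Set.mem_union, Set.mem_ofPred_eq, Set.mem_iUnion, List.mem_sublists] at h ⊢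
    exact h.imp (List.sublist_of_cons_sublist ·)
      fun ⟨ρ, hρ, h⟩ => ⟨ρ, hρ, List.sublist_of_cons_sublist h⟩
  have hrule : ∀ ρ ∈ g.rules, ρ.output ∈ S := by
    intro ρ hρ
    simp only [S, Set.mem_union, Set.mem_ofPred_eq, Set.mem_iUnion, List.mem_sublists]
    exact .inr ⟨ρ, hρ, .refl _⟩
  have hinit : [.nonterminal g.initial] ∈ S := by
    simp only [S, Set.mem_union, Set.mem_ofPred_eq, List.mem_sublists]
    exact .inl (.refl _)
  refine ⟨S, hS, fun s y => ParsesTo g s y, fun w hw t ht htw => ?_⟩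
  obtain ⟨s, hs, x, y, z, heq, H⟩ := ParsesTo.exists_factor htail hrule (L := g.language) ht
    (ParsesTo.of_derives hw) hinit (by omega) (x := []) (z := [])
    (fun y hy => by rw [List.nil_append, List.append_nil]; exact hy.derives)
  exact ⟨⟨s, hs⟩, x, y, z, by simpa using heq, H⟩

/-! ### Exchanging factors of `ℓ aⁿ bⁿ r # r aⁿ bⁿ ℓ`. -/

theorem append_eq_append_singleton_append {α : Type} {x y z u v : List α} {c : α}
    (h : x ++ y ++ z = u ++ c :: v) :
    (∃ t, z = t ++ c :: v ∧ x ++ y ++ t = u) ∨ (∃ t, x = u ++ c :: t ∧ t ++ y ++ z = v) ∨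
      ∃ p q, y = p ++ c :: q ∧ x ++ p = u ∧ q ++ z = v := by
  rcases List.append_eq_append_iff.1 h with ⟨s, rfl, h2⟩ | ⟨s, h1, h2⟩
  · exact .inl ⟨s, h2, rfl⟩
  · cases s with
    | nil => exact .inl ⟨[], by simpa using h2.symm, by simpa using h1⟩
    | cons d s =>
      obtain ⟨rfl, rfl⟩ := List.cons.inj h2
      rcases List.append_eq_append_iff.1 h1 with ⟨p, rfl, h3⟩ | ⟨p, rfl, h3⟩
      · exact .inr (.inr ⟨p, s, h3, rfl, rfl⟩)
      · cases p with
        | nil => exact .inr (.inr ⟨[], s, by simpa using h3.symm, by simp, rfl⟩)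
        | cons e p =>
          obtain ⟨rfl, rfl⟩ := List.cons.inj h3
          exact .inr (.inl ⟨p, by simp, by simp⟩)

/-- The first half of the word `ℓ aⁿ bⁿ r # r aⁿ bⁿ ℓ`. -/
def leftHalf (n : ℕ) : List (Option Letter) :=
  some l :: (List.replicate n (some a) ++ (List.replicate n (some b) ++ [some r]))

/-- The second half of the word `ℓ aⁿ bⁿ r # r aⁿ bⁿ ℓ`. -/
def rightHalf (n : ℕ) : List (Option Letter) :=
  some r :: (List.replicate n (some a) ++ (List.replicate n (some b) ++ [some l]))

theorem mem_unfold_halves (n : ℕ) :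
    leftHalf n ++ none :: rightHalf n ∈
      unfold (wordProblem (PresentedMonoid.of M₁Rel : Letter → M₁)) := by
  refine ⟨l :: core true n, l :: core false n, ?_, ?_⟩
  · rw [mem_wordProblem_iff]
    simpa using SwapEquiv.swap true n .nil
  · simp [leftHalf, rightHalf, core, ab]

/-- The relations only permute letters. The bound on `none` makes the displayed `none` the
separator. -/
theorem perm_of_mem_unfold {u v : List (Option Letter)}
    (h : u ++ none :: v ∈ unfold (wordProblem (PresentedMonoid.of M₁Rel : Letter → M₁)))
    (hcount : (u ++ none :: v).count none ≤ 1) : u.Perm v := by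
  obtain ⟨u', v', huv, heq⟩ := h
  rw [mem_wordProblem_iff] at huv
  simp only [List.count_append, List.count_cons_self] at hcount
  have hu : none ∉ u := fun h => by have := List.count_pos_iff.2 h; omega
  have hv : none ∉ v := fun h => by have := List.count_pos_iff.2 h; omega
  rw [List.append_assoc, List.singleton_append] at heq
  obtain ⟨rfl, -, rfl⟩ := (List.append_cons_inj_of_notMem hu hv).1 heq
  exact (huv.perm.map _).trans (v'.reverse_perm.symm.map _)

theorem count_none_of_mem_unfold {w : List (Option Letter)}
    (h : w ∈ unfold (wordProblem (PresentedMonoid.of M₁Rel : Letter → M₁))) :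
    w.count none = 1 := by
  obtain ⟨u, v, -, rfl⟩ := h
  have : ∀ u : List Letter, (u.map some).count none = 0 := fun u =>
    List.count_eq_zero.2 (by simp)
  simp [List.count_append, this]

theorem count_of_sublist_replicate_append {α : Type} [BEq α] [LawfulBEq α] {p : List α} {n : ℕ}
    {c d e : α} (hec : e ≠ c) (hed : e ≠ d) (h : p.Sublist (List.replicate n c ++ [d])) :
    p.count e = 0 ∧ p.length ≤ p.count c + 1 := by
  obtain ⟨p₁, p₂, rfl, h₁, h₂⟩ := List.sublist_append_iff.1 h
  obtain ⟨k, -, rfl⟩ := List.sublist_replicate_iff.1 h₁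
  have hlen := h₂.length_le
  have hcount := h₂.count_le e
  rw [List.count_singleton, if_neg (by simpa using hed.symm)] at hcount
  rw [List.length_singleton] at hlen
  simp only [List.count_append, List.count_replicate, List.length_append, List.length_replicate,
    beq_self_eq_true, if_true, beq_eq_false_iff_ne.2 hec.symm,
    Bool.false_eq_true, if_false]
  omega

/-- Such a suffix is too short to reach past `bⁿ r`. -/
theorem count_of_suffix_leftHalf {p : List (Option Letter)} {n : ℕ} (h : p <:+ leftHalf n)
    (hp : p.length ≤ n) : p.count (some a) = 0 ∧ p.length ≤ p.count (some b) + 1 := by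
  have h' : List.replicate n (some b) ++ [some r] <:+ leftHalf n :=
    ⟨some l :: List.replicate n (some a), by simp [leftHalf]⟩
  exact count_of_sublist_replicate_append (by simp) (by simp)
    (List.suffix_of_suffix_length_le h h' (by simp; omega)).sublist

theorem count_of_prefix_rightHalf {q : List (Option Letter)} {n : ℕ} (h : q <+: rightHalf n)
    (hq : q.length ≤ n) : q.count (some b) = 0 ∧ q.length ≤ q.count (some a) + 1 := by
  have h' : some r :: List.replicate n (some a) <+: rightHalf n :=
    ⟨List.replicate n (some b) ++ [some l], by simp [rightHalf]⟩
  have := (List.prefix_of_prefix_length_le h h' (by simp; omega)).sublist.reverse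
  rw [List.reverse_cons, List.reverse_replicate] at this
  simpa using count_of_sublist_replicate_append (e := some b) (by simp) (by simp) this

theorem none_notMem_leftHalf (n : ℕ) : none ∉ leftHalf n := by
  simp [leftHalf, List.mem_replicate]

theorem none_notMem_rightHalf (n : ℕ) : none ∉ rightHalf n := by
  simp [rightHalf, List.mem_replicate]

theorem halves_perm (n : ℕ) : (leftHalf n).Perm (rightHalf n) :=
  perm_of_mem_unfold (mem_unfold_halves n) (count_none_of_mem_unfold (mem_unfold_halves n)).le

/-- A short factor of `ℓ aⁿ bⁿ r # r aⁿ bⁿ ℓ` cannot be replaced by a short factor of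
`ℓ aᵐ bᵐ r # r aᵐ bᵐ ℓ` of a very different length. -/
theorem length_le_of_interchange {n m : ℕ} {x y z x' y' z' : List (Option Letter)}
    (hw : x ++ y ++ z = leftHalf n ++ none :: rightHalf n) (hy : y.length ≤ n)
    (hw' : x' ++ y' ++ z' = leftHalf m ++ none :: rightHalf m) (hy' : y'.length ≤ m)
    (hmem : x ++ y' ++ z ∈ unfold (wordProblem (PresentedMonoid.of M₁Rel : Letter → M₁))) :
    y'.length ≤ y.length + 2 := by
  have hlen := (halves_perm n).length_eq
  have hcount := count_none_of_mem_unfold hmem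
  rcases append_eq_append_singleton_append hw with
    ⟨t, rfl, ht⟩ | ⟨t, rfl, ht⟩ | ⟨p, q, rfl, hp, hq⟩
  -- If `y` avoids `#`, the other side is unchanged, and balance forces `y'` to have the length of
  -- `y`.
  · rw [← List.append_assoc] at hmem hcount
    have := (perm_of_mem_unfold hmem hcount.le).length_eq
    rw [← hlen, ← ht] at this
    simp only [List.length_append] at this
    omega
  · rw [List.append_assoc, List.append_assoc, List.cons_append, ← List.append_assoc] at hmem
    rw [List.append_assoc, List.append_assoc, List.cons_append, ← List.append_assoc] at hcount
    have := (perm_of_mem_unfold hmem hcount.le).length_eq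
    rw [hlen, ← ht] at this
    simp only [List.length_append] at this
    omega
  have hx0 : x.count none = 0 :=
    List.count_eq_zero.2 fun h => none_notMem_leftHalf n (hp ▸ List.mem_append_left _ h)
  have hz0 : z.count none = 0 :=
    List.count_eq_zero.2 fun h => none_notMem_rightHalf n (hq ▸ List.mem_append_right _ h)
  rw [List.count_append, List.count_append, hx0, hz0] at hcount
  -- Now `y = p # q`, so `y'` must supply the only `#`.
  rcases append_eq_append_singleton_append hw' with
    ⟨t, rfl, ht⟩ | ⟨t, rfl, ht⟩ | ⟨p', q', rfl, hp', hq'⟩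
  · have : y'.count none = 0 := List.count_eq_zero.2 fun h => none_notMem_leftHalf m (by
      rw [← ht]; exact List.mem_append_left _ (List.mem_append_right _ h))
    omega
  · have : y'.count none = 0 := List.count_eq_zero.2 fun h => none_notMem_rightHalf m (by
      rw [← ht]; exact List.mem_append_left _ (List.mem_append_right _ h))
    omega
  have heq : x ++ (p' ++ none :: q') ++ z = (x ++ p') ++ none :: (q' ++ z) := by simp
  have hperm : (x ++ p').Perm (q' ++ z) := by
    refine perm_of_mem_unfold (heq ▸ hmem) ?_
    rw [← heq, List.count_append, List.count_append, hx0, hz0]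
    omega
  have hperm₀ : (x ++ p).Perm (q ++ z) := by rw [hp, hq]; exact halves_perm n
  simp only [List.length_append, List.length_cons] at hy hy' ⊢
  have h₁ := count_of_suffix_leftHalf ⟨x, hp⟩ (by omega)
  have h₂ := count_of_prefix_rightHalf ⟨z, hq⟩ (by omega)
  have h₃ := count_of_suffix_leftHalf ⟨x', hp'⟩ (by omega)
  have h₄ := count_of_prefix_rightHalf ⟨z', hq'⟩ (by omega)
  have ha := hperm.count_eq (some a)
  have hb := hperm.count_eq (some b)
  have ha₀ := hperm₀.count_eq (some a)
  have hb₀ := hperm₀.count_eq (some b)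
  simp only [List.count_append] at ha hb ha₀ hb₀
  have := List.count_le_length (a := some b) (l := p)
  have := List.count_le_length (a := some a) (l := q)
  -- Comparing the two balances shows that `p` and `p'` have equally many `b`s, `q` and `q'` equally
  -- many `a`s. Each side may gain one `r`, whence the 2.
  omega

theorem wordProblem_notMem_U_contextFree :
    wordProblem (PresentedMonoid.of M₁Rel : Letter → M₁) ∉ U contextFree Letter := by
  intro hcf
  obtain ⟨ι, _, P, hP⟩ := exists_interchange hcf
  have hlen (n : ℕ) : n ≤ (leftHalf n ++ none :: rightHalf n).length := by
    simp only [leftHalf, List.length_append, List.length_cons, List.length_nil,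
      List.length_replicate]
    omega
  -- With ratio 8, for `j < k` the factor at `k` is longer than `4 * 8 ^ j`, hence exceeds the one
  -- at `j` by more than 2.
  choose i x y z hw hle hlt hPi hmem using fun k : ℕ =>
    hP _ (mem_unfold_halves (8 ^ k)) (8 ^ k) (Nat.one_le_pow _ _ (by norm_num)) (hlen _)
  obtain ⟨j, k, hjk, hi⟩ : ∃ j k, j < k ∧ i j = i k := by
    obtain ⟨j, k, hne, hi⟩ := Finite.exists_ne_map_eq_of_infinite i
    rcases hne.lt_or_gt with h | h
    · exact ⟨j, k, h, hi⟩
    · exact ⟨k, j, h, hi.symm⟩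
  have := length_le_of_interchange (hw j) (hle j) (hw k) (hle k) (hmem j _ (hi ▸ hPi k))
  have hpow : 8 ^ (j + 1) ≤ 8 ^ k := Nat.pow_le_pow_right (by norm_num) hjk
  have := hle j
  have := hlt j
  have := hlt k
  have : 1 ≤ 8 ^ j := Nat.one_le_pow _ _ (by norm_num)
  rw [pow_succ] at hpow
  omega

end WordRelations

open WordRelations in
theorem proposition6p5 :
    wordProblem (PresentedMonoid.of M₁Rel : Letter → M₁) ∈ T oneCounter Letter ∧
      wordProblem (PresentedMonoid.of M₁Rel : Letter → M₁) ∉ U contextFree Letter :=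
  ⟨wordProblem_mem_T_oneCounter, wordProblem_notMem_U_contextFree⟩
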